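/- Let $f : K \to L$ be a map of simplicial sets. For a simplex $\sigma : \Delta^n \to L$ ($n \ge 0$, possibly degenerate), let $\underline{\mathrm{Hom}}_{\Delta^n}\big(\Delta^n, \Delta^n \times_L K\big)$ be the relative internal Hom, i.e. the simplicial set of sections of the projection $\Delta^n \times_L K \to \Delta^n$: its $m$-simplices are the maps $\Delta^m \times \Delta^n \to \Delta^n \times_L K$ over $\Delta^n$ (where $\Delta^m \times \Delta^n$ lies over $\Delta^n$ by the second projection); equivalently, they are the maps $g : \Delta^m \times \Delta^n \to K$ with $f \circ g = \sigma \circ \mathrm{pr}_2$. Here a map of simplicial sets $A \to B$ is called a homotopy equivalence if it is a weak equivalence in the Kan model structure, i.e. if for every Kan complex $Z$ the induced map $\pi_0 \mathrm{Map}(B, Z) \to \pi_0 \mathrm{Map}(A, Z)$ is a bijection, where $\mathrm{Map}$ is the internal Hom of simplicial sets; and a simplicial set is contractible if its map to the point $\Delta^0$ is a homotopy equivalence. Theorem. If for every $n \ge 0$ and every simplex $\sigma : \Delta^n \to L$ the simplicial set $$\underline{\mathrm{Hom}}_{\Delta^n}\big(\Delta^n, \Delta^n \times_L K\big)$$ is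 contractible, then $f$ is a homotopy equivalence. -/

import Mathlib

open CategoryTheory MonoidalCategory CartesianMonoidalCategory Simplicial Opposite

universe u

namespace SSet

/-- A map of simplicial sets `f : K ⟶ L` is a (weak) homotopy equivalence, i.e. a weak equivalence
of the Kan model structure, if for every Kan complex `Z`, precomposition with `f` induces
a bijection `π₀ (Fun(L, Z)) → π₀ (Fun(K, Z))` on simplicial homotopy classes of maps. -/
def IsWeakHomotopyEquiv {K L : SSet.{u}} (f : K ⟶ L) : Prop :=
  ∀ (Z : SSet.{u}) [KanComplex Z],
    Function.Bijective (mapπ₀ ((MonoidalClosed.pre f).app Z))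

/-- A simplicial set is contractible if its map to the point `Δ[0]` is
a (weak) homotopy equivalence. -/
def IsContractible (K : SSet.{u}) : Prop :=
  IsWeakHomotopyEquiv (stdSimplex.isTerminalObj₀.from K)

/-- The relative internal Hom of two simplicial sets `p : X ⟶ B` and `q : Y ⟶ B` over `B`:
its `m`-simplices are the maps `Δ[m] ⊗ X ⟶ Y` over `B`. -/
def relHom {X Y B : SSet.{u}} (p : X ⟶ B) (q : Y ⟶ B) : SSet.{u} where
  obj m := {g : stdSimplex.{u}.obj m.unop ⊗ X ⟶ Y // g ≫ q = snd _ _ ≫ p}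
  map φ := ↾fun g ↦ ⟨stdSimplex.{u}.map φ.unop ▷ X ≫ g.1, by
    rw [Category.assoc, g.2, whiskerRight_snd_assoc]⟩
  map_id m := by
    ext g : 3
    apply Subtype.ext
    have h : stdSimplex.{u}.map (𝟙 m.unop) = 𝟙 _ :=
      CategoryTheory.Functor.map_id _ _
    change stdSimplex.{u}.map (𝟙 m.unop) ▷ X ≫ g.1 = g.1
    rw [h, id_whiskerRight, Category.id_comp]
  map_comp φ ψ := by
    ext g : 3
    apply Subtype.ext
    have h : stdSimplex.{u}.map (ψ.unop ≫ φ.unop) =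
        stdSimplex.{u}.map ψ.unop ≫ stdSimplex.{u}.map φ.unop :=
      CategoryTheory.Functor.map_comp _ _ _
    change stdSimplex.{u}.map (ψ.unop ≫ φ.unop) ▷ X ≫ g.1 = _
    rw [h, comp_whiskerRight, Category.assoc]
    rfl

end SSet

/-! Let `Y = partialSections f`: its column `Y n` is the disjoint union, over the `n`-simplices `σ`
of `L`, of the spaces of sections over `σ`. Evaluation on the diagonal of `Δ[n] ⊗ Δ[n]` gives a map
`diag Y ⟶ K`, and sending a simplex of `K` to the family constant in the first variable gives a
section of it. The composite `diag Y ⟶ K ⟶ L` just remembers `σ`. By `of_retraction` it suffices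
that this composite is a weak equivalence.

By hypothesis each projection from `Y n` to the discrete set `L n` is a weak equivalence
(`isWeakHomotopyEquiv_partialSectionsFst`). To pass to diagonals, factor it as a monomorphism `Y n ⟶
L n ⊗ cofreeCone (Y n)` followed by a projection with an explicit, functorial contraction. The
contraction passes directly to the diagonal. The monomorphism is a levelwise weak equivalence, and
`Sub.isWeakHomotopyEquiv_diag` treats it by attaching the pieces `Y n ⊗ Δ[n]` one at a time.

Attaching arguments need monic weak equivalences to be stable under pushouts and countable unions.
This follows from `hasKanExtensions` and `hasKanHomotopyExtensions`: they are equivalent to strict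
extension properties for maps to, and homotopies in, Kan complexes. -/

namespace SSet

/-! ### Simplicial identities for edges and triangles. -/

section LowDimension

variable (X : SSet.{u}) (t : X _⦋2⦌) (e : X _⦋1⦌)

lemma δ_one_δ_zero_triangle : X.δ 1 (X.δ 0 t) = X.δ 0 (X.δ 2 t) :=
  (δ_comp_δ_apply (i := 0) (j := 1) (by decide) t).symm

lemma δ_zero_δ_zero_triangle : X.δ 0 (X.δ 0 t) = X.δ 0 (X.δ 1 t) :=
  (δ_comp_δ_apply (i := 0) (j := 0) (by decide) t).symm

lemma δ_one_δ_one_triangle : X.δ 1 (X.δ 1 t) = X.δ 1 (X.δ 2 t) :=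
  (δ_comp_δ_apply (i := 1) (j := 1) (by decide) t).symm

lemma δ_zero_σ_zero_edge : X.δ 0 (X.σ 0 e) = e := δ_comp_σ_self_apply 0 e

lemma δ_one_σ_zero_edge : X.δ 1 (X.σ 0 e) = e := δ_comp_σ_succ_apply 0 e

lemma δ_two_σ_zero_edge : X.δ 2 (X.σ 0 e) = X.σ 0 (X.δ 1 e) :=
  δ_comp_σ_of_gt_apply (i := 1) (j := 0) (by decide) e

lemma δ_zero_σ_one_edge : X.δ 0 (X.σ 1 e) = X.σ 0 (X.δ 0 e) :=
  δ_comp_σ_of_le_apply (i := 0) (j := 0) (by decide) e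

lemma δ_one_σ_one_edge : X.δ 1 (X.σ 1 e) = e := δ_comp_σ_self_apply 1 e

lemma δ_two_σ_one_edge : X.δ 2 (X.σ 1 e) = e := δ_comp_σ_succ_apply 1 e

end LowDimension

/-! ### Lifting of edges and triangles along Kan fibrations. -/

section KanFibrations

open modelCategoryQuillen HomotopicalAlgebra

variable {E B : SSet.{u}} (p : E ⟶ B)

/-- Lifting of a triangle along a Kan fibration, the face `d₀` being unknown. -/
lemma exists_lift_horn₂₀ [Fibration p] (e₂ e₁ : E _⦋1⦌) (h : E.δ 1 e₂ = E.δ 1 e₁) (b : B _⦋2⦌)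
    (hb₂ : B.δ 2 b = p.app _ e₂) (hb₁ : B.δ 1 b = p.app _ e₁) :
    ∃ x : E _⦋2⦌, E.δ 2 x = e₂ ∧ E.δ 1 x = e₁ ∧ p.app _ x = b := by
  let f : ∀ (j : Fin 3) (_ : j ≠ 0), Δ[1] ⟶ E := fun j _ ↦
    yonedaEquiv.symm (if j = 1 then e₁ else e₂)
  have hf : horn.IsCompatible f := by
    rw [horn.isCompatible_iff]
    intro j k hj hk hjk
    obtain rfl : j = 1 := by fin_cases j <;> fin_cases k <;> simp_all
    obtain rfl : k = 2 := by fin_cases k <;> simp_all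
    simp only [f, stdSimplex.δ_comp_yonedaEquiv_symm]
    exact congrArg yonedaEquiv.symm h.symm
  obtain ⟨φ, h₁, h₂⟩ := hf.exists_lift p (yonedaEquiv.symm b) (by
    intro j hj
    rw [stdSimplex.δ_comp_yonedaEquiv_symm, yonedaEquiv_symm_comp]
    congr 1
    obtain rfl | rfl : j = 1 ∨ j = 2 := by fin_cases j <;> simp_all
    · exact hb₁.symm
    · exact hb₂.symm)
  have h₃ (j : Fin 3) (hj : j ≠ 0) : E.δ j (yonedaEquiv φ) = if j = 1 then e₁ else e₂ := by
    rw [← stdSimplex.yonedaEquiv_δ_comp, h₁ j hj, Equiv.apply_symm_apply]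
  refine ⟨yonedaEquiv φ, h₃ 2 (by simp), h₃ 1 (by simp), ?_⟩
  rw [← yonedaEquiv_comp, h₂, Equiv.apply_symm_apply]

/-- Lifting of a triangle along a Kan fibration, the face `d₁` being unknown. -/
lemma exists_lift_horn₂₁ [Fibration p] (e₂ e₀ : E _⦋1⦌) (h : E.δ 0 e₂ = E.δ 1 e₀) (b : B _⦋2⦌)
    (hb₂ : B.δ 2 b = p.app _ e₂) (hb₀ : B.δ 0 b = p.app _ e₀) :
    ∃ x : E _⦋2⦌, E.δ 2 x = e₂ ∧ E.δ 0 x = e₀ ∧ p.app _ x = b := by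
  let f : ∀ (j : Fin 3) (_ : j ≠ 1), Δ[1] ⟶ E := fun j _ ↦
    yonedaEquiv.symm (if j = 0 then e₀ else e₂)
  have hf : horn.IsCompatible f := by
    rw [horn.isCompatible_iff]
    intro j k hj hk hjk
    obtain rfl : j = 0 := by fin_cases j <;> fin_cases k <;> simp_all
    obtain rfl : k = 2 := by fin_cases k <;> simp_all
    simp only [f, stdSimplex.δ_comp_yonedaEquiv_symm]
    exact congrArg yonedaEquiv.symm h.symm
  obtain ⟨φ, h₁, h₂⟩ := hf.exists_lift p (yonedaEquiv.symm b) (by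
    intro j hj
    rw [stdSimplex.δ_comp_yonedaEquiv_symm, yonedaEquiv_symm_comp]
    congr 1
    obtain rfl | rfl : j = 0 ∨ j = 2 := by fin_cases j <;> simp_all
    · exact hb₀.symm
    · exact hb₂.symm)
  have h₃ (j : Fin 3) (hj : j ≠ 1) : E.δ j (yonedaEquiv φ) = if j = 0 then e₀ else e₂ := by
    rw [← stdSimplex.yonedaEquiv_δ_comp, h₁ j hj, Equiv.apply_symm_apply]
  refine ⟨yonedaEquiv φ, h₃ 2 (by simp), h₃ 0 (by simp), ?_⟩
  rw [← yonedaEquiv_comp, h₂, Equiv.apply_symm_apply]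

/-- Kan fibrations have the path lifting property. -/
lemma exists_lift_edge [Fibration p] (x : E _⦋0⦌) (b : B _⦋1⦌) (hb : B.δ 1 b = p.app _ x) :
    ∃ e : E _⦋1⦌, E.δ 1 e = x ∧ p.app _ e = b := by
  -- The horn `Λ[1, 0]` is a single vertex, so there is no compatibility to check.
  have hf : horn.IsCompatible (n := 0) (i := 0) (fun _ _ ↦ yonedaEquiv.symm x) := trivial
  obtain ⟨φ, h₁, h₂⟩ := hf.exists_lift p (yonedaEquiv.symm b) (by
    intro j hj
    rw [stdSimplex.δ_comp_yonedaEquiv_symm, yonedaEquiv_symm_comp]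
    congr 1
    obtain rfl : j = 1 := by fin_cases j <;> simp_all
    exact hb.symm)
  refine ⟨yonedaEquiv φ, ?_, ?_⟩
  · rw [← stdSimplex.yonedaEquiv_δ_comp, h₁ 1 (by simp), Equiv.apply_symm_apply]
  · rw [← yonedaEquiv_comp, h₂, Equiv.apply_symm_apply]

lemma KanComplex.exists_triangle [KanComplex E] (e₂ e₁ : E _⦋1⦌) (h : E.δ 1 e₂ = E.δ 1 e₁) :
    ∃ x : E _⦋2⦌, E.δ 2 x = e₂ ∧ E.δ 1 x = e₁ := by
  have (n : ℕ) : Subsingleton ((⊤_ SSet.{u}) _⦋n⦌) :=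
    ⟨fun a b ↦ yonedaEquiv.symm.injective (Limits.terminalIsTerminal.hom_ext _ _)⟩
  obtain ⟨x, h₁, h₂, -⟩ := exists_lift_horn₂₀ (Limits.terminal.from E) e₂ e₁ h
    ((Limits.terminal.from E).app _ (E.σ 0 e₂)) (Subsingleton.elim _ _) (Subsingleton.elim _ _)
  exact ⟨x, h₁, h₂⟩

/-- Filling of a `Λ[2, 0]` horn. Taking `e'` degenerate gives symmetry of the edge relation, and
transitivity follows. -/
lemma KanComplex.exists_edge [KanComplex E] {x y z : E _⦋0⦌} (e : Edge x y) (e' : Edge x z) :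
    Nonempty (Edge y z) := by
  obtain ⟨t, h₂, h₁⟩ := KanComplex.exists_triangle e.edge e'.edge (by simp)
  refine ⟨Edge.mk (E.δ 0 t) ?_ ?_⟩
  · rw [← e.tgt_eq, ← h₂]
    exact ConcreteCategory.congr_hom (E.δ_comp_δ (i := 0) (j := 1) (by simp)) t |>.symm
  · rw [← e'.tgt_eq, ← h₁]
    exact ConcreteCategory.congr_hom (E.δ_comp_δ (i := 0) (j := 0) (by simp)) t |>.symm

lemma KanComplex.π₀_mk_eq_iff [KanComplex E] (x y : E _⦋0⦌) :
    π₀.mk x = π₀.mk y ↔ Nonempty (Edge x y) := by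
  refine ⟨fun h ↦ ?_, fun ⟨e⟩ ↦ π₀.sound e⟩
  rw [π₀.mk_eq_mk_iff] at h
  induction h with
  | rel _ _ h => exact h
  | refl x => exact ⟨.id x⟩
  | symm _ _ _ h =>
    obtain ⟨e⟩ := h
    exact exists_edge e (.id _)
  | trans _ _ _ _ _ h h' =>
    obtain ⟨e⟩ := h
    obtain ⟨e'⟩ := h'
    obtain ⟨e''⟩ := exists_edge e (.id _)
    exact exists_edge e'' e'

/-- Let `p` be a Kan fibration with a section. If `p` is injective on homotopy classes
of vertices, then edges of the base lift with prescribed endpoints. -/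
lemma exists_lift_edge_of_section [Fibration p] (s : B ⟶ E) (hs : s ≫ p = 𝟙 B)
    (hp : ∀ x y : E _⦋0⦌, p.app _ x = p.app _ y → Nonempty (Edge x y))
    {x y : E _⦋0⦌} (b : Edge (p.app _ x) (p.app _ y)) :
    ∃ e : Edge x y, p.app _ e.edge = b.edge := by
  have hs' {n : ℕ} (z : B _⦋n⦌) : p.app _ (s.app _ z) = z := by
    simpa using ConcreteCategory.congr_hom (congr_app hs _) z
  -- Any edge `k` from `s (p z)` to `z` projects to a loop. Correcting `k` by the loop `s (p k)`
  -- makes it vertical, that is, lying over a degenerate edge.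
  have key (z : E _⦋0⦌) : ∃ e : Edge (s.app _ (p.app _ z)) z,
      p.app _ e.edge = B.σ 0 (p.app _ z) := by
    obtain ⟨k⟩ := hp (s.app _ (p.app _ z)) z (hs' _)
    obtain ⟨t, h₂, h₁, ht⟩ := exists_lift_horn₂₀ p (s.app _ (p.app _ k.edge)) k.edge
      (by simp only [← δ_naturality_apply, k.src_eq, hs'])
      (B.σ 1 (p.app _ k.edge)) (by rw [hs', δ_two_σ_one_edge]) (by rw [δ_one_σ_one_edge])
    refine ⟨Edge.mk (x₀ := s.app _ (p.app _ z)) (x₁ := z) (E.δ 0 t) ?_ ?_, ?_⟩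
    · rw [δ_one_δ_zero_triangle, h₂]
      simp only [← δ_naturality_apply, k.tgt_eq]
    · rw [δ_zero_δ_zero_triangle, h₁, k.tgt_eq]
    · rw [Edge.mk_edge _ _ _, δ_naturality_apply, ht, δ_zero_σ_one_edge, ← δ_naturality_apply, k.tgt_eq]
  obtain ⟨ex, hex⟩ := key x
  obtain ⟨ey, hey⟩ := key y
  -- The lift of `b` is the path `x ← s (p x) → s (p y) → y`: its middle edge is `s b` and its outer
  -- edges are vertical. The fillers `t` and `t'` compose it over degenerate triangles on `b`.
  obtain ⟨t, h₂, h₀, ht⟩ := exists_lift_horn₂₁ p (s.app _ b.edge) ey.edge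
    (by rw [← δ_naturality_apply, b.tgt_eq, ey.src_eq])
    (B.σ 1 b.edge) (by rw [hs', δ_two_σ_one_edge])
    (by rw [hey, δ_zero_σ_one_edge, b.tgt_eq])
  obtain ⟨t', h₂', h₁', ht'⟩ := exists_lift_horn₂₀ p ex.edge (E.δ 1 t)
    (by rw [ex.src_eq, δ_one_δ_one_triangle, h₂, ← δ_naturality_apply, b.src_eq])
    (B.σ 0 b.edge) (by rw [hex, δ_two_σ_zero_edge, b.src_eq])
    (by rw [δ_naturality_apply, ht, δ_one_σ_zero_edge, δ_one_σ_one_edge])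
  refine ⟨Edge.mk (x₀ := x) (x₁ := y) (E.δ 0 t') ?_ ?_, ?_⟩
  · rw [δ_one_δ_zero_triangle, h₂', ex.tgt_eq]
  · rw [δ_zero_δ_zero_triangle, h₁', ← δ_zero_δ_zero_triangle, h₀, ey.tgt_eq]
  · rw [Edge.mk_edge _ _ _, δ_naturality_apply, ht', δ_zero_σ_zero_edge]

end KanFibrations

end SSet

namespace SSet

/-! ### Vertices and edges of mapping spaces; homotopies. -/

section MappingSpaces

variable {A B Z : SSet.{u}}

/-- Vertices of the internal hom are morphisms. -/
noncomputable def ihomVertexEquiv : (A ⟶ Z) ≃ ((ihom A).obj Z) _⦋0⦌ where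
  toFun f := yonedaEquiv (MonoidalClosed.curry (fst A Δ[0] ≫ f))
  invFun x := lift (𝟙 A) (stdSimplex.isTerminalObj₀.from A) ≫
    MonoidalClosed.uncurry (yonedaEquiv.symm x)
  left_inv f := by simp
  right_inv x := by
    have : fst A Δ[0] ≫ lift (𝟙 A) (stdSimplex.isTerminalObj₀.from A) = 𝟙 _ := by
      ext : 1
      · simp
      · exact stdSimplex.isTerminalObj₀.hom_ext _ _
    have h : fst A Δ[0] ≫ lift (𝟙 A) (stdSimplex.isTerminalObj₀.from A) ≫
        MonoidalClosed.uncurry (yonedaEquiv.symm x) =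
          MonoidalClosed.uncurry (yonedaEquiv.symm x) := by
      rw [reassoc_of% this]
    exact (congrArg (fun g ↦ yonedaEquiv (MonoidalClosed.curry g)) h).trans
      ((congrArg yonedaEquiv (MonoidalClosed.curry_uncurry _)).trans
        (Equiv.apply_symm_apply _ _))

/-- Edges of the internal hom are homotopies. -/
noncomputable def ihomEdgeEquiv : (A ⊗ Δ[1] ⟶ Z) ≃ ((ihom A).obj Z) _⦋1⦌ where
  toFun H := yonedaEquiv (MonoidalClosed.curry H)
  invFun x := MonoidalClosed.uncurry (yonedaEquiv.symm x)
  left_inv H := by simp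
  right_inv x := by simp

lemma whiskerLeft_δ_one (A : SSet.{u}) :
    A ◁ stdSimplex.δ (1 : Fin 2) = fst A Δ[0] ≫ ι₀ := by
  rw [stdSimplex.δ_one_eq_const]
  rfl

lemma whiskerLeft_δ_zero (A : SSet.{u}) :
    A ◁ stdSimplex.δ (0 : Fin 2) = fst A Δ[0] ≫ ι₁ := by
  rw [stdSimplex.δ_zero_eq_const]
  rfl

lemma δ_one_ihomEdgeEquiv (H : A ⊗ Δ[1] ⟶ Z) :
    ((ihom A).obj Z).δ 1 (ihomEdgeEquiv H) = ihomVertexEquiv (ι₀ ≫ H) := by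
  dsimp [ihomEdgeEquiv, ihomVertexEquiv]
  rw [← stdSimplex.yonedaEquiv_δ_comp, ← MonoidalClosed.curry_natural_left,
    whiskerLeft_δ_one, Category.assoc]

lemma δ_zero_ihomEdgeEquiv (H : A ⊗ Δ[1] ⟶ Z) :
    ((ihom A).obj Z).δ 0 (ihomEdgeEquiv H) = ihomVertexEquiv (ι₁ ≫ H) := by
  dsimp [ihomEdgeEquiv, ihomVertexEquiv]
  rw [← stdSimplex.yonedaEquiv_δ_comp, ← MonoidalClosed.curry_natural_left,
    whiskerLeft_δ_zero, Category.assoc]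

lemma pre_app_ihomVertexEquiv (j : A ⟶ B) (f : B ⟶ Z) :
    ((MonoidalClosed.pre j).app Z).app _ (ihomVertexEquiv f) = ihomVertexEquiv (j ≫ f) := by
  dsimp [ihomVertexEquiv]
  rw [← yonedaEquiv_comp, MonoidalClosed.curry_pre_app, whiskerRight_fst_assoc]

lemma pre_app_ihomEdgeEquiv (j : A ⟶ B) (H : B ⊗ Δ[1] ⟶ Z) :
    ((MonoidalClosed.pre j).app Z).app _ (ihomEdgeEquiv H) =
      ihomEdgeEquiv (j ▷ Δ[1] ≫ H) := by
  dsimp [ihomEdgeEquiv]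
  rw [← yonedaEquiv_comp, MonoidalClosed.curry_pre_app]

/-- Two maps are homotopic if there is a homotopy from the first to the second. -/
def Homotopic (f g : A ⟶ Z) : Prop :=
  ∃ H : A ⊗ Δ[1] ⟶ Z, ι₀ ≫ H = f ∧ ι₁ ≫ H = g

lemma nonempty_edge_iff_homotopic (f g : A ⟶ Z) :
    Nonempty (Edge (ihomVertexEquiv f) (ihomVertexEquiv g)) ↔ Homotopic f g := by
  constructor
  · rintro ⟨e⟩
    obtain ⟨H, hH⟩ := ihomEdgeEquiv.surjective e.edge
    refine ⟨H, ihomVertexEquiv.injective ?_, ihomVertexEquiv.injective ?_⟩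
    · rw [← δ_one_ihomEdgeEquiv, hH, e.src_eq]
    · rw [← δ_zero_ihomEdgeEquiv, hH, e.tgt_eq]
  · rintro ⟨H, rfl, rfl⟩
    exact ⟨Edge.mk (ihomEdgeEquiv H) (δ_one_ihomEdgeEquiv H) (δ_zero_ihomEdgeEquiv H)⟩

lemma π₀_mk_eq_iff_homotopic [KanComplex Z] (f g : A ⟶ Z) :
    π₀.mk (ihomVertexEquiv f) = π₀.mk (ihomVertexEquiv g) ↔ Homotopic f g := by
  rw [KanComplex.π₀_mk_eq_iff, nonempty_edge_iff_homotopic]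

lemma Homotopic.refl (f : A ⟶ Z) : Homotopic f f :=
  ⟨fst _ _ ≫ f, by simp, by simp⟩

lemma Homotopic.symm [KanComplex Z] {f g : A ⟶ Z} (h : Homotopic f g) : Homotopic g f := by
  rw [← π₀_mk_eq_iff_homotopic] at h ⊢
  exact h.symm

lemma Homotopic.precomp {f g : B ⟶ Z} (h : Homotopic f g) (a : A ⟶ B) :
    Homotopic (a ≫ f) (a ≫ g) := by
  obtain ⟨H, rfl, rfl⟩ := h
  exact ⟨a ▷ Δ[1] ≫ H, by simp, by simp⟩

lemma Homotopic.postcomp {f g : A ⟶ B} (h : Homotopic f g) (b : B ⟶ Z) :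
    Homotopic (f ≫ b) (g ≫ b) := by
  obtain ⟨H, rfl, rfl⟩ := h
  exact ⟨H ≫ b, by simp, by simp⟩

end MappingSpaces

/-! ### Formal properties of weak equivalences. -/

section WeakEquivalences

variable {A B C : SSet.{u}}

lemma isWeakHomotopyEquiv_iff (j : A ⟶ B) :
    IsWeakHomotopyEquiv j ↔ ∀ (Z : SSet.{u}) [KanComplex Z],
      (∀ g : A ⟶ Z, ∃ h : B ⟶ Z, Homotopic (j ≫ h) g) ∧
      (∀ h h' : B ⟶ Z, Homotopic (j ≫ h) (j ≫ h') → Homotopic h h') := by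
  refine forall₂_congr fun Z _ ↦ ⟨fun ⟨h₁, h₂⟩ ↦ ⟨fun g ↦ ?_, fun h h' hh ↦ ?_⟩,
    fun ⟨h₁, h₂⟩ ↦ ⟨fun x y hxy ↦ ?_, fun x ↦ ?_⟩⟩
  · obtain ⟨x, hx⟩ := h₂ (π₀.mk (ihomVertexEquiv g))
    obtain ⟨x, rfl⟩ := π₀.mk_surjective x
    obtain ⟨h, rfl⟩ := ihomVertexEquiv.surjective x
    rw [mapπ₀_mk, pre_app_ihomVertexEquiv, π₀_mk_eq_iff_homotopic] at hx
    exact ⟨h, hx⟩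
  · rw [← π₀_mk_eq_iff_homotopic] at hh ⊢
    apply h₁
    simpa only [mapπ₀_mk, pre_app_ihomVertexEquiv] using hh
  · obtain ⟨x, rfl⟩ := π₀.mk_surjective x
    obtain ⟨y, rfl⟩ := π₀.mk_surjective y
    obtain ⟨f, rfl⟩ := ihomVertexEquiv.surjective x
    obtain ⟨g, rfl⟩ := ihomVertexEquiv.surjective y
    simp only [mapπ₀_mk, pre_app_ihomVertexEquiv, π₀_mk_eq_iff_homotopic] at hxy ⊢
    exact h₂ _ _ hxy
  · obtain ⟨x, rfl⟩ := π₀.mk_surjective x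
    obtain ⟨g, rfl⟩ := ihomVertexEquiv.surjective x
    obtain ⟨h, hh⟩ := h₁ g
    refine ⟨π₀.mk (ihomVertexEquiv h), ?_⟩
    rwa [mapπ₀_mk, pre_app_ihomVertexEquiv, π₀_mk_eq_iff_homotopic]

lemma mapπ₀_pre_comp (f : A ⟶ B) (g : B ⟶ C) (Z : SSet.{u}) :
    mapπ₀ ((MonoidalClosed.pre (f ≫ g)).app Z) =
      mapπ₀ ((MonoidalClosed.pre f).app Z) ∘ mapπ₀ ((MonoidalClosed.pre g).app Z) := by
  ext x
  rw [MonoidalClosed.pre_map, NatTrans.comp_app, mapπ₀_comp_apply, Function.comp_apply]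

namespace IsWeakHomotopyEquiv

lemma comp {f : A ⟶ B} {g : B ⟶ C} (hf : IsWeakHomotopyEquiv f) (hg : IsWeakHomotopyEquiv g) :
    IsWeakHomotopyEquiv (f ≫ g) := fun Z _ ↦ by
  rw [mapπ₀_pre_comp]
  exact (hf Z).comp (hg Z)

lemma of_comp_left {f : A ⟶ B} {g : B ⟶ C} (hf : IsWeakHomotopyEquiv f)
    (hfg : IsWeakHomotopyEquiv (f ≫ g)) : IsWeakHomotopyEquiv g := fun Z _ ↦ by
  have := hfg Z
  rw [mapπ₀_pre_comp] at this
  exact (Function.Bijective.of_comp_iff' (hf Z) _).1 this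

lemma of_comp_right {f : A ⟶ B} {g : B ⟶ C} (hg : IsWeakHomotopyEquiv g)
    (hfg : IsWeakHomotopyEquiv (f ≫ g)) : IsWeakHomotopyEquiv f := fun Z _ ↦ by
  have := hfg Z
  rw [mapπ₀_pre_comp] at this
  exact (Function.Bijective.of_comp_iff _ (hg Z)).1 this

lemma of_homotopic_id {s : B ⟶ A} {r : A ⟶ B} (h : s ≫ r = 𝟙 B)
    (h' : Homotopic (𝟙 A) (r ≫ s)) : IsWeakHomotopyEquiv r := by
  rw [isWeakHomotopyEquiv_iff]
  intro Z _
  refine ⟨fun g ↦ ⟨s ≫ g, ?_⟩, fun g g' hg ↦ ?_⟩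
  · simpa using (h'.postcomp g).symm
  · simpa [reassoc_of% h] using hg.precomp s

lemma of_isIso (f : A ⟶ B) [IsIso f] : IsWeakHomotopyEquiv f :=
  of_homotopic_id (s := inv f) (by simp) (by simpa using Homotopic.refl _)

/-- If a weak homotopy equivalence `π : D ⟶ C` factors as a retraction followed by `f`,
then `f` is a weak homotopy equivalence. -/
lemma of_retraction {D : SSet.{u}} {f : A ⟶ C} {i : A ⟶ D} {r : D ⟶ A} (hi : i ≫ r = 𝟙 A)
    (h : IsWeakHomotopyEquiv (r ≫ f)) : IsWeakHomotopyEquiv f := by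
  -- The retraction is itself a weak equivalence: precomposition with `r` is injective because of
  -- `i`, and surjective because precomposition with `r ≫ f` is.
  refine of_comp_left (f := r) (fun Z _ ↦ ⟨?_, ?_⟩) h
  · refine Function.LeftInverse.injective (g := mapπ₀ ((MonoidalClosed.pre i).app Z)) (fun x ↦ ?_)
    rw [← Function.comp_apply (f := mapπ₀ _), ← mapπ₀_pre_comp, hi, MonoidalClosed.pre_id,
      NatTrans.id_app, mapπ₀_id_apply]
  · have := (h Z).surjective
    rw [mapπ₀_pre_comp] at this
    exact this.of_comp

end IsWeakHomotopyEquiv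

end WeakEquivalences

end SSet

namespace SSet

/-! ### Monic weak equivalences via extension properties, and their pushouts. -/

open modelCategoryQuillen HomotopicalAlgebra

variable {A B Z : SSet.{u}}

/-- The homotopy extension property of monomorphisms with respect to Kan complexes. -/
lemma exists_homotopy_extension [KanComplex Z] (j : A ⟶ B) [Mono j] (h : B ⟶ Z)
    (H : A ⊗ Δ[1] ⟶ Z) (hH : ι₀ ≫ H = j ≫ h) :
    ∃ G : B ⊗ Δ[1] ⟶ Z, ι₀ ≫ G = h ∧ j ▷ Δ[1] ≫ G = H := by
  -- Restriction of maps to `Z` along a monomorphism is a Kan fibration, and `H` is a path in its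
  -- base.
  obtain ⟨e, he, he'⟩ := exists_lift_edge ((MonoidalClosed.pre j).app Z) (ihomVertexEquiv h)
    (ihomEdgeEquiv H) (by rw [δ_one_ihomEdgeEquiv, hH, pre_app_ihomVertexEquiv])
  obtain ⟨G, rfl⟩ := ihomEdgeEquiv.surjective e
  refine ⟨G, ihomVertexEquiv.injective ?_, ihomEdgeEquiv.injective ?_⟩
  · rw [← he, δ_one_ihomEdgeEquiv]
  · rw [← he', pre_app_ihomEdgeEquiv]

section Curry

variable {T : SSet.{u}}

lemma whiskerLeft_ι₀_associator_inv (T A : SSet.{u}) :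
    T ◁ (ι₀ : A ⟶ A ⊗ Δ[1]) ≫ (α_ T A Δ[1]).inv = ι₀ := rfl

lemma whiskerLeft_ι₁_associator_inv (T A : SSet.{u}) :
    T ◁ (ι₁ : A ⟶ A ⊗ Δ[1]) ≫ (α_ T A Δ[1]).inv = ι₁ := rfl

lemma Homotopic.curry {f g : T ⊗ A ⟶ Z} (h : Homotopic f g) :
    Homotopic (MonoidalClosed.curry f) (MonoidalClosed.curry g) := by
  obtain ⟨H, rfl, rfl⟩ := h
  refine ⟨MonoidalClosed.curry ((α_ T A Δ[1]).inv ≫ H), ?_, ?_⟩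
  · rw [← MonoidalClosed.curry_natural_left, ← Category.assoc, whiskerLeft_ι₀_associator_inv]
  · rw [← MonoidalClosed.curry_natural_left, ← Category.assoc, whiskerLeft_ι₁_associator_inv]

lemma Homotopic.uncurry {f g : A ⟶ (ihom T).obj Z} (h : Homotopic f g) :
    Homotopic (MonoidalClosed.uncurry f) (MonoidalClosed.uncurry g) := by
  obtain ⟨H, rfl, rfl⟩ := h
  refine ⟨(α_ T A Δ[1]).hom ≫ MonoidalClosed.uncurry H, ?_, ?_⟩
  · rw [MonoidalClosed.uncurry_natural_left, ← Category.assoc]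
    rfl
  · rw [MonoidalClosed.uncurry_natural_left, ← Category.assoc]
    rfl

/-- Homotopies transpose along currying, and `(ihom T).obj Z` is a Kan complex when `Z` is. -/
lemma IsWeakHomotopyEquiv.whiskerLeft {j : A ⟶ B} (hj : IsWeakHomotopyEquiv j) (T : SSet.{u}) :
    IsWeakHomotopyEquiv (T ◁ j) := by
  rw [isWeakHomotopyEquiv_iff] at hj ⊢
  intro Z _
  obtain ⟨h₁, h₂⟩ := hj ((ihom T).obj Z)
  refine ⟨fun g ↦ ?_, fun h h' hh ↦ ?_⟩
  · obtain ⟨h, hh⟩ := h₁ (MonoidalClosed.curry g)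
    refine ⟨MonoidalClosed.uncurry h, ?_⟩
    simpa [MonoidalClosed.uncurry_natural_left] using hh.uncurry
  · have := (h₂ (MonoidalClosed.curry h) (MonoidalClosed.curry h')
      (by simpa [MonoidalClosed.curry_natural_left] using hh.curry)).uncurry
    simpa using this

lemma IsWeakHomotopyEquiv.whiskerRight {j : A ⟶ B} (hj : IsWeakHomotopyEquiv j) (T : SSet.{u}) :
    IsWeakHomotopyEquiv (j ▷ T) := by
  have : j ▷ T = (β_ A T).hom ≫ T ◁ j ≫ (β_ T B).hom := by simp
  rw [this]
  exact (of_isIso _).comp ((hj.whiskerLeft T).comp (of_isIso _))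

end Curry

instance (j : A ⟶ B) [Mono j] (T : SSet.{u}) : Mono (j ▷ T) where
  right_cancellation a b h := by
    ext : 1
    · rw [← cancel_mono j]
      simpa using h =≫ fst _ _
    · simpa using h =≫ snd _ _

/-- A morphism `j` has the extension property if Kan complexes are injective relatively to it. -/
def HasKanExtensions (j : A ⟶ B) : Prop :=
  ∀ (Z : SSet.{u}) [KanComplex Z] (g : A ⟶ Z), ∃ h : B ⟶ Z, j ≫ h = g

/-- A morphism `j` has the homotopy lifting property if homotopies between restrictions
along `j` of maps to Kan complexes extend. -/
def HasKanHomotopyExtensions (j : A ⟶ B) : Prop :=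
  ∀ (Z : SSet.{u}) [KanComplex Z] (h₀ h₁ : B ⟶ Z) (G : A ⊗ Δ[1] ⟶ Z),
    ι₀ ≫ G = j ≫ h₀ → ι₁ ≫ G = j ≫ h₁ →
      ∃ H : B ⊗ Δ[1] ⟶ Z, ι₀ ≫ H = h₀ ∧ ι₁ ≫ H = h₁ ∧ j ▷ Δ[1] ≫ H = G

lemma IsWeakHomotopyEquiv.of_extensions {j : A ⟶ B} (h₁ : HasKanExtensions j)
    (h₂ : HasKanHomotopyExtensions j) : IsWeakHomotopyEquiv j := by
  rw [isWeakHomotopyEquiv_iff]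
  intro Z _
  refine ⟨fun g ↦ ?_, fun h h' ⟨G, hG₀, hG₁⟩ ↦ ?_⟩
  · obtain ⟨h, rfl⟩ := h₁ Z g
    exact ⟨h, .refl _⟩
  · obtain ⟨H, hH₀, hH₁, -⟩ := h₂ Z h h' G hG₀ hG₁
    exact ⟨H, hH₀, hH₁⟩

/-- An extension exists up to homotopy; homotopy extension makes it strict. -/
lemma IsWeakHomotopyEquiv.hasKanExtensions {j : A ⟶ B} [Mono j] (hj : IsWeakHomotopyEquiv j) :
    HasKanExtensions j := by
  intro Z _ g
  obtain ⟨h, H, hH₀, hH₁⟩ := ((isWeakHomotopyEquiv_iff j).1 hj Z).1 g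
  obtain ⟨G, -, hG⟩ := exists_homotopy_extension j h H hH₀
  exact ⟨ι₁ ≫ G, by rw [← hH₁, ← hG, ι₁_comp_assoc]⟩

lemma IsWeakHomotopyEquiv.hasKanHomotopyExtensions {j : A ⟶ B} [Mono j]
    (hj : IsWeakHomotopyEquiv j) : HasKanHomotopyExtensions j := by
  intro Z _ h₀ h₁ G hG₀ hG₁
  -- Extending the evaluation map `A ⊗ (ihom A).obj Z ⟶ Z` along `j` yields a section of the
  -- restriction fibration, as `exists_lift_edge_of_section` requires.
  obtain ⟨S, hS⟩ := (hj.whiskerRight ((ihom A).obj Z)).hasKanExtensions Z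
    (MonoidalClosed.uncurry (𝟙 _))
  obtain ⟨e, he⟩ := exists_lift_edge_of_section ((MonoidalClosed.pre j).app Z)
    (MonoidalClosed.curry S)
    (by rw [MonoidalClosed.curry_pre_app, hS, MonoidalClosed.curry_uncurry])
    (by
      intro x y hxy
      obtain ⟨f, rfl⟩ := ihomVertexEquiv.surjective x
      obtain ⟨g, rfl⟩ := ihomVertexEquiv.surjective y
      rw [pre_app_ihomVertexEquiv, pre_app_ihomVertexEquiv,
        Equiv.apply_eq_iff_eq] at hxy
      rw [nonempty_edge_iff_homotopic]
      apply ((isWeakHomotopyEquiv_iff j).1 hj Z).2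
      rw [hxy]
      exact .refl _)
    (x := ihomVertexEquiv h₀) (y := ihomVertexEquiv h₁)
    (Edge.mk (ihomEdgeEquiv G)
      (by rw [δ_one_ihomEdgeEquiv, pre_app_ihomVertexEquiv, hG₀])
      (by rw [δ_zero_ihomEdgeEquiv, pre_app_ihomVertexEquiv, hG₁]))
  obtain ⟨H, hH⟩ := ihomEdgeEquiv.surjective e.edge
  refine ⟨H, ihomVertexEquiv.injective ?_, ihomVertexEquiv.injective ?_,
    ihomEdgeEquiv.injective ?_⟩
  · rw [← δ_one_ihomEdgeEquiv, hH, e.src_eq]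
  · rw [← δ_zero_ihomEdgeEquiv, hH, e.tgt_eq]
  · rw [← pre_app_ihomEdgeEquiv, hH, he, Edge.mk_edge _ _ _]

section Pushouts

variable {A' B' : SSet.{u}} {f : A ⟶ A'} {j : A ⟶ B} {j' : A' ⟶ B'} {g : B ⟶ B'}

lemma HasKanExtensions.of_isPushout (sq : IsPushout f j j' g) (hj : HasKanExtensions j) :
    HasKanExtensions j' := by
  intro Z _ a
  obtain ⟨h, hh⟩ := hj Z (f ≫ a)
  exact ⟨sq.desc a h hh.symm, by simp⟩

lemma HasKanHomotopyExtensions.of_isPushout (sq : IsPushout f j j' g)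
    (hj : HasKanHomotopyExtensions j) : HasKanHomotopyExtensions j' := by
  intro Z _ h₀ h₁ G hG₀ hG₁
  obtain ⟨H, hH₀, hH₁, hH⟩ := hj Z (g ≫ h₀) (g ≫ h₁) (f ▷ Δ[1] ≫ G)
    (by rw [ι₀_comp_assoc, hG₀, sq.w_assoc]) (by rw [ι₁_comp_assoc, hG₁, sq.w_assoc])
  -- Tensoring with `Δ[1]` preserves pushouts, so the homotopies glue.
  have sq' : IsPushout (f ▷ Δ[1]) (j ▷ Δ[1]) (j' ▷ Δ[1]) (g ▷ Δ[1]) :=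
    sq.map (tensorRight Δ[1])
  refine ⟨sq'.desc G H hH.symm, ?_, ?_, by simp⟩
  · apply sq.hom_ext
    · rw [← ι₀_comp_assoc, sq'.inl_desc, hG₀]
    · rw [← ι₀_comp_assoc, sq'.inr_desc, hH₀]
  · apply sq.hom_ext
    · rw [← ι₁_comp_assoc, sq'.inl_desc, hG₁]
    · rw [← ι₁_comp_assoc, sq'.inr_desc, hH₁]

lemma IsWeakHomotopyEquiv.of_isPushout [Mono j] (sq : IsPushout f j j' g)
    (hj : IsWeakHomotopyEquiv j) : IsWeakHomotopyEquiv j' :=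
  .of_extensions (hj.hasKanExtensions.of_isPushout sq)
    (hj.hasKanHomotopyExtensions.of_isPushout sq)

end Pushouts

/-- The inclusion of `S ⊗ Y` in the union is a pushout of `S ⊗ T ⟶ X ⊗ T`; two-out-of-three against
`S ⊗ Y ⟶ X ⊗ Y` concludes. -/
lemma IsWeakHomotopyEquiv.unionProd {X Y : SSet.{u}} (S : X.Subcomplex) (T : Y.Subcomplex)
    (hS : IsWeakHomotopyEquiv S.ι) : IsWeakHomotopyEquiv (S.unionProd T).ι := by
  have h : IsWeakHomotopyEquiv (Subcomplex.unionProd.ι₂ S T) :=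
    (hS.whiskerRight (T : SSet)).of_isPushout (Subcomplex.unionProd.isPushout S T).flip
  exact h.of_comp_left (by simpa using hS.whiskerRight Y)

section Attaching

variable {P D : SSet.{u}} (Q : P ⟶ D) (F : D.Subcomplex)

/-- Degreewise, the simplices outside `F` are hit by exactly one simplex of `P`, so the range of `Q`
is glued to `F` along the preimage of `F`. -/
lemma isPushout_of_injOn_compl_preimage
    (hQ : ∀ (n : SimplexCategoryᵒᵖ) (x y : P.obj n), Q.app n x ∉ F.obj n → Q.app n y ∉ F.obj n →
      Q.app n x = Q.app n y → x = y) :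
    IsPushout (F.fromPreimage Q) (F.preimage Q).ι
      (Subcomplex.homOfLE (le_sup_left : F ≤ F ⊔ Subcomplex.range Q))
      (Subcomplex.lift Q (le_sup_right : Subcomplex.range Q ≤ F ⊔ Subcomplex.range Q)) where
  w := rfl
  isColimit' := ⟨Limits.evaluationJointlyReflectsColimits _ (fun n ↦ by
    refine (Limits.isColimitMapCoconePushoutCoconeEquiv _ _).2
      (IsPushout.isColimit ?_)
    refine Limits.Types.isPushout_of_isPullback_of_mono' ?_ ?_ ?_
    · rw [Limits.Types.isPullback_iff]
      refine ⟨rfl, fun x y ⟨_, h⟩ ↦ Subtype.ext h, fun x y h ↦ ?_⟩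
      have h' : x.1 = Q.app n y := congrArg Subtype.val h
      have hy : Q.app n y ∈ F.obj n := h' ▸ x.2
      exact ⟨⟨y, hy⟩, Subtype.ext h'.symm, rfl⟩
    · refine Set.eq_univ_of_forall fun x ↦ ?_
      obtain ⟨x, hx | ⟨y, hy⟩⟩ := x
      · exact Or.inl ⟨⟨x, hx⟩, rfl⟩
      · exact Or.inr ⟨y, Subtype.ext hy⟩
    · intro x y hx hy h
      exact hQ n x y (fun h' ↦ hx ⟨⟨x, h'⟩, rfl⟩) (fun h' ↦ hy ⟨⟨y, h'⟩, rfl⟩)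
        (congrArg Subtype.val h))⟩

end Attaching

end SSet

namespace SSet

lemma IsWeakHomotopyEquiv.sup_range {P D : SSet.{u}} (Q : P ⟶ D) (F : D.Subcomplex)
    (hQ : ∀ (n : SimplexCategoryᵒᵖ) (x y : P.obj n), Q.app n x ∉ F.obj n → Q.app n y ∉ F.obj n →
      Q.app n x = Q.app n y → x = y)
    (h : IsWeakHomotopyEquiv (F.preimage Q).ι) :
    IsWeakHomotopyEquiv
      (Subcomplex.homOfLE (le_sup_left : F ≤ F ⊔ Subcomplex.range Q)) :=
  h.of_isPushout (isPushout_of_injOn_compl_preimage Q F hQ)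

/-- A bisimplicial set, seen as a simplicial object in simplicial sets. -/
abbrev Bisimplicial := SimplexCategoryᵒᵖ ⥤ SSet.{u}

/-! ### Latching objects of bisimplicial subsets. -/

namespace Bisimplicial

variable (Y : Bisimplicial.{u})

/-- A bisimplicial subset. -/
structure Sub where
  /-- the underlying family of subcomplexes -/
  obj (n : SimplexCategoryᵒᵖ) : (Y.obj n).Subcomplex
  map {n m : SimplexCategoryᵒᵖ} (φ : n ⟶ m) : obj n ≤ (obj m).preimage (Y.map φ)

variable {Y} (A : Sub Y)

/-- The subcomplex of the `n`th simplicial set of a bisimplicial set consisting of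
simplices which are in `A` or are degenerate in the horizontal direction. -/
def Sub.latching (n : ℕ) : (Y.obj (op ⦋n⦌)).Subcomplex where
  obj k := (A.obj _).obj k ∪ SSet.degenerate (Y.flip.obj k) n
  map φ := by
    rintro x (hx | hx)
    · exact Or.inl ((A.obj _).map φ hx)
    · exact Or.inr (degenerate_app_apply hx (Y.flip.map φ))

/-- The subcomplex generated by `A` and the images of the degeneracies `σ j` for `j < i`. -/
def Sub.partialLatching (n i : ℕ) : (Y.obj (op ⦋n + 1⦌)).Subcomplex :=
  A.obj _ ⊔ ⨆ (j : Fin (n + 1)) (_ : j.1 < i), Subcomplex.range (SimplicialObject.σ Y j)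

lemma Sub.mem_partialLatching_iff {n i : ℕ} {k : SimplexCategoryᵒᵖ}
    (x : (Y.obj (op ⦋n + 1⦌)).obj k) :
    x ∈ (A.partialLatching n i).obj k ↔ x ∈ (A.obj _).obj k ∨
      ∃ (j : Fin (n + 1)) (_ : j.1 < i) (y : (Y.flip.obj k) _⦋n⦌),
        SimplicialObject.σ (Y.flip.obj k) j y = x := by
  simp only [partialLatching, Subfunctor.max_obj, Subfunctor.iSup_obj, Set.mem_union,
    Set.mem_iUnion]
  rfl

lemma Sub.map_mem {n m : SimplexCategoryᵒᵖ} (φ : n ⟶ m) {k : SimplexCategoryᵒᵖ}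
    {x : (Y.flip.obj k).obj n} (hx : x ∈ (A.obj n).obj k) :
    (Y.flip.obj k).map φ x ∈ (A.obj m).obj k := A.map φ k hx

lemma Sub.partialLatching_zero (n : ℕ) : A.partialLatching n 0 = A.obj _ := by
  ext k x
  simp [mem_partialLatching_iff]

lemma Sub.partialLatching_succ (n i : ℕ) (hi : i < n + 1) :
    A.partialLatching n (i + 1) =
      A.partialLatching n i ⊔ Subcomplex.range (SimplicialObject.σ Y (⟨i, hi⟩ : Fin (n + 1))) := by
  ext k x
  change _ ↔ x ∈ (A.partialLatching n i).obj k ∨ _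
  rw [mem_partialLatching_iff, mem_partialLatching_iff, or_assoc]
  refine or_congr_right ⟨?_, ?_⟩
  · rintro ⟨j, hj, y, rfl⟩
    obtain hj | rfl := (Nat.lt_succ_iff.1 hj).lt_or_eq
    · exact Or.inl ⟨j, hj, y, rfl⟩
    · exact Or.inr ⟨y, rfl⟩
  · rintro (⟨j, hj, y, rfl⟩ | ⟨y, rfl⟩)
    · exact ⟨j, by lia, y, rfl⟩
    · exact ⟨⟨i, hi⟩, by simp, y, rfl⟩

lemma Sub.σ_mem_iff {n : ℕ} (i : Fin (n + 1)) {k : SimplexCategoryᵒᵖ}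
    (x : (Y.flip.obj k) _⦋n⦌) :
    SimplicialObject.σ (Y.flip.obj k) i x ∈ (A.obj (op ⦋n + 1⦌)).obj k ↔
      x ∈ (A.obj (op ⦋n⦌)).obj k := by
  refine ⟨fun h ↦ ?_, fun h ↦ A.map_mem _ h⟩
  rw [← δ_comp_σ_self_apply i x]
  exact A.map_mem _ h

/-- If `σ i x = σ j y` with `j < i`, applying the face `i + 1` gives `x = σ j (δ i y)`; conversely
`σ i` and `σ j` commute up to a shift of index. -/
lemma Sub.preimage_partialLatching_succ (n i : ℕ) (hi : i < n + 2) :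
    (A.partialLatching (n + 1) i).preimage (SimplicialObject.σ Y (⟨i, hi⟩ : Fin (n + 2))) =
      A.partialLatching n i := by
  ext k x
  change SimplicialObject.σ (Y.flip.obj k) (⟨i, hi⟩ : Fin (n + 2)) x ∈
    (A.partialLatching (n + 1) i).obj k ↔ _
  rw [mem_partialLatching_iff, mem_partialLatching_iff, σ_mem_iff]
  refine or_congr_right ⟨?_, ?_⟩
  · rintro ⟨j, hj, y, h⟩
    obtain ⟨j, rfl⟩ := Fin.eq_castSucc_of_ne_last (x := j) (by grind)
    refine ⟨j, hj, SimplicialObject.δ (Y.flip.obj k) (⟨i, hi⟩ : Fin (n + 2)) y, ?_⟩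
    rw [← δ_comp_σ_of_gt_apply (show j.castSucc < ⟨i, hi⟩ from hj), h, δ_comp_σ_succ_apply]
  · rintro ⟨j, hj, y, rfl⟩
    obtain ⟨b, hb⟩ := Fin.exists_succ_eq.2 (show (⟨i, hi⟩ : Fin (n + 2)) ≠ 0 by grind)
    rw [← hb]
    refine ⟨j.castSucc, hj, SimplicialObject.σ (Y.flip.obj k) b y, ?_⟩
    exact σ_comp_σ_apply (by grind) y

/-- Degeneracies are attached one by one. Attaching the injective map `σ i` glues along a partial
latching object with the same `i`, one horizontal degree lower, so the induction on `i` covers all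
`n` at once. -/
lemma Sub.isWeakHomotopyEquiv_partialLatching (hA : ∀ n, IsWeakHomotopyEquiv (A.obj n).ι)
    (i n : ℕ) (hi : i ≤ n + 1) :
    IsWeakHomotopyEquiv (A.partialLatching n i).ι := by
  induction i generalizing n with
  | zero =>
    rw [partialLatching_zero]
    exact hA _
  | succ i hi' =>
    rw [partialLatching_succ _ _ _ hi]
    refine IsWeakHomotopyEquiv.of_comp_left (IsWeakHomotopyEquiv.sup_range _ _ ?_ ?_)
      (hi' n (by lia))
    · intro k x y _ _ h
      have := congrArg (SimplicialObject.δ (Y.flip.obj k) (⟨i, hi⟩ : Fin (n + 1)).castSucc) h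
      exact (δ_comp_σ_self_apply (S := Y.flip.obj k) _ x).symm.trans
        (this.trans (δ_comp_σ_self_apply (S := Y.flip.obj k) _ y))
    · obtain _ | n := n
      · obtain rfl : i = 0 := by lia
        have : (A.partialLatching 0 0).preimage
            (SimplicialObject.σ Y (⟨0, hi⟩ : Fin 1)) = A.obj _ := by
          rw [partialLatching_zero]
          ext k x
          exact A.σ_mem_iff _ _
        rw [this]
        exact hA _
      · rw [preimage_partialLatching_succ]
        exact hi' n (by lia)

lemma Sub.isWeakHomotopyEquiv_latching (hA : ∀ n, IsWeakHomotopyEquiv (A.obj n).ι) (n : ℕ) :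
    IsWeakHomotopyEquiv (A.latching n).ι := by
  obtain _ | n := n
  · have : A.latching 0 = A.obj _ := by
      ext k x
      change x ∈ _ ∪ _ ↔ _
      simp
    rw [this]
    exact hA _
  · have : A.latching (n + 1) = A.partialLatching n (n + 1) := by
      ext k x
      rw [mem_partialLatching_iff]
      change x ∈ _ ∪ _ ↔ _
      simp only [degenerate_eq_iUnion_range_σ, Set.mem_union, Set.mem_iUnion, Fin.is_lt,
        Set.mem_range, exists_true_left]
    rw [this]
    exact A.isWeakHomotopyEquiv_partialLatching hA _ _ le_rfl

end Bisimplicial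
end SSet

/-! ### Countable filtrations, and the filtration of the diagonal. -/

namespace SSet

lemma HasKanExtensions.of_filtration {D : SSet.{u}} (F : ℕ → D.Subcomplex)
    (hF : ∀ n, F n ≤ F (n + 1))
    (hF' : ∀ (k : SimplexCategoryᵒᵖ) (x : D.obj k), ∃ n, x ∈ (F n).obj k)
    (h : ∀ n, HasKanExtensions (Subcomplex.homOfLE (hF n))) :
    HasKanExtensions (F 0).ι := by
  intro Z _ g₀
  choose e he using fun n (g : (F n : SSet) ⟶ Z) ↦ h n Z g
  let g (n : ℕ) : (F n : SSet) ⟶ Z := Nat.rec g₀ e n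
  have hg {n m : ℕ} (hnm : n ≤ m) {k : SimplexCategoryᵒᵖ} (x : D.obj k) (hx : x ∈ (F n).obj k)
      (hx' : x ∈ (F m).obj k) : (g m).app k ⟨x, hx'⟩ = (g n).app k ⟨x, hx⟩ := by
    induction m, hnm using Nat.le_induction with
    | base => rfl
    | succ m hnm hm =>
      rw [← hm (monotone_nat_of_le_succ hF hnm _ hx)]
      exact ConcreteCategory.congr_hom (congr_app (he m (g m)) k)
        ⟨x, monotone_nat_of_le_succ hF hnm _ hx⟩
  have hg' {n m : ℕ} {k : SimplexCategoryᵒᵖ} (x : D.obj k) (hx : x ∈ (F n).obj k)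
      (hx' : x ∈ (F m).obj k) : (g m).app k ⟨x, hx'⟩ = (g n).app k ⟨x, hx⟩ := by
    obtain hnm | hnm := le_total n m
    · exact hg hnm x hx hx'
    · exact (hg hnm x hx' hx).symm
  choose N hN using hF'
  refine ⟨{ app k := ↾fun x ↦ (g (N k x)).app k ⟨x, hN k x⟩, naturality := ?_ }, ?_⟩
  · intro k k' φ
    ext x
    exact (hg' (D.map φ x) ((F _).map φ (hN k x)) (hN _ _)).trans
      (NatTrans.naturality_apply (g (N k x)) φ ⟨x, hN k x⟩)
  · ext k x
    exact hg' x.1 x.2 _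

lemma HasKanHomotopyExtensions.of_filtration {D : SSet.{u}} (F : ℕ → D.Subcomplex)
    (hF : ∀ n, F n ≤ F (n + 1))
    (hF' : ∀ (k : SimplexCategoryᵒᵖ) (x : D.obj k), ∃ n, x ∈ (F n).obj k)
    (h : ∀ n, HasKanHomotopyExtensions (Subcomplex.homOfLE (hF n))) :
    HasKanHomotopyExtensions (F 0).ι := by
  intro Z _ h₀ h₁ g₀ hg₀ hg₁
  -- The endpoint conditions are carried along the recursion, so that each stage can be extended
  -- again.
  let T (n : ℕ) := { G : (F n : SSet) ⊗ Δ[1] ⟶ Z //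
    ι₀ ≫ G = (F n).ι ≫ h₀ ∧ ι₁ ≫ G = (F n).ι ≫ h₁ }
  choose e he₀ he₁ he using fun n (G : T n) ↦ h n Z ((F (n + 1)).ι ≫ h₀) ((F (n + 1)).ι ≫ h₁)
    G.1 G.2.1 G.2.2
  let g (n : ℕ) : T n := Nat.rec ⟨g₀, hg₀, hg₁⟩ (fun n G ↦ ⟨e n G, he₀ n G, he₁ n G⟩) n
  have hg {n m : ℕ} (hnm : n ≤ m) {k : SimplexCategoryᵒᵖ} (x : D.obj k) (b : Δ[1].obj k)
      (hx : x ∈ (F n).obj k) (hx' : x ∈ (F m).obj k) :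
      (g m).1.app k ⟨⟨x, hx'⟩, b⟩ = (g n).1.app k ⟨⟨x, hx⟩, b⟩ := by
    induction m, hnm using Nat.le_induction with
    | base => rfl
    | succ m hnm hm =>
      rw [← hm (monotone_nat_of_le_succ hF hnm _ hx)]
      exact ConcreteCategory.congr_hom (congr_app (he m (g m)) k)
        ⟨⟨x, monotone_nat_of_le_succ hF hnm _ hx⟩, b⟩
  have hg' {n m : ℕ} {k : SimplexCategoryᵒᵖ} (x : D.obj k) (b : Δ[1].obj k)
      (hx : x ∈ (F n).obj k) (hx' : x ∈ (F m).obj k) :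
      (g m).1.app k ⟨⟨x, hx'⟩, b⟩ = (g n).1.app k ⟨⟨x, hx⟩, b⟩ := by
    obtain hnm | hnm := le_total n m
    · exact hg hnm x b hx hx'
    · exact (hg hnm x b hx' hx).symm
  choose N hN using hF'
  refine ⟨{ app k := ↾fun x ↦ (g (N k x.1)).1.app k ⟨⟨x.1, hN k x.1⟩, x.2⟩,
            naturality := ?_ }, ?_, ?_, ?_⟩
  · intro k k' φ
    ext ⟨x, b⟩
    exact (hg' (D.map φ x) (Δ[1].map φ b) ((F _).map φ (hN k x)) (hN _ _)).trans
      (NatTrans.naturality_apply (g (N k x)).1 φ ⟨⟨x, hN k x⟩, b⟩)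
  · ext k x
    exact ConcreteCategory.congr_hom (congr_app (g (N k x)).2.1 k) ⟨x, hN k x⟩
  · ext k x
    exact ConcreteCategory.congr_hom (congr_app (g (N k x)).2.2 k) ⟨x, hN k x⟩
  · ext k ⟨x, b⟩
    exact hg' x.1 b x.2 _

lemma IsWeakHomotopyEquiv.of_filtration {D : SSet.{u}} (F : ℕ → D.Subcomplex)
    (hF : ∀ n, F n ≤ F (n + 1))
    (hF' : ∀ (k : SimplexCategoryᵒᵖ) (x : D.obj k), ∃ n, x ∈ (F n).obj k)
    (h : ∀ n, IsWeakHomotopyEquiv (Subcomplex.homOfLE (hF n))) :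
    IsWeakHomotopyEquiv (F 0).ι :=
  .of_extensions (.of_filtration F hF hF' fun n ↦ (h n).hasKanExtensions)
    (.of_filtration F hF hF' fun n ↦ (h n).hasKanHomotopyExtensions)

namespace Bisimplicial

variable (Y : Bisimplicial.{u})

/-- The diagonal of a bisimplicial set. -/
def diag : SSet.{u} where
  obj k := (Y.obj k).obj k
  map φ := (Y.obj _).map φ ≫ (Y.map φ).app _
  map_comp φ ψ := by
    simp only [Functor.map_comp, NatTrans.comp_app, Category.assoc, NatTrans.naturality_assoc]

/-- The canonical map to the diagonal of a bisimplicial set from the product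
of one of its columns and the corresponding standard simplex. -/
def toDiag (n : ℕ) : Y.obj (op ⦋n⦌) ⊗ Δ[n] ⟶ diag Y where
  app k := ↾fun x ↦ (Y.flip.obj k).map (stdSimplex.objEquiv x.2).op x.1
  naturality k k' φ := by
    ext ⟨y, β⟩
    obtain ⟨f, rfl⟩ := stdSimplex.objEquiv.symm.surjective β
    change (Y.map (φ.unop ≫ f).op).app k' ((Y.obj _).map φ y) =
      (Y.map φ).app _ ((Y.obj _).map φ ((Y.map f.op).app k y))
    rw [op_comp, Functor.map_comp, NatTrans.comp_app]
    exact congrArg ((Y.map φ).app k') (NatTrans.naturality_apply (Y.map f.op) φ y)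

variable {Y} (A : Sub Y)

/-- The diagonal of a bisimplicial subset. -/
def Sub.diag : (diag Y).Subcomplex where
  obj k := (A.obj k).obj k
  map φ _ hx := A.map φ _ ((A.obj _).map φ hx)

/-- The filtration of the diagonal. -/
def Sub.filtration (n : ℕ) : (Bisimplicial.diag Y).Subcomplex :=
  Nat.rec A.diag (fun n F ↦ F ⊔ Subcomplex.range (toDiag Y n)) n

lemma Sub.filtration_le (n : ℕ) : A.filtration n ≤ A.filtration (n + 1) := le_sup_left

lemma Sub.mem_filtration_iff (n : ℕ) {k : SimplexCategoryᵒᵖ} (x : (Y.obj k).obj k) :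
    x ∈ (A.filtration n).obj k ↔ x ∈ (A.obj k).obj k ∨
      ∃ (p : ℕ) (_ : p < n) (f : k.unop ⟶ ⦋p⦌) (y : (Y.flip.obj k) _⦋p⦌),
        (Y.flip.obj k).map f.op y = x := by
  induction n with
  | zero =>
    simp only [not_lt_zero, IsEmpty.exists_iff, exists_const, or_false]
    rfl
  | succ n hn =>
    change x ∈ (A.filtration n).obj k ∨ _ ↔ _
    rw [hn, or_assoc]
    refine or_congr_right ⟨?_, ?_⟩
    · rintro (⟨p, hp, f, y, rfl⟩ | ⟨⟨y, β⟩, rfl⟩)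
      · exact ⟨p, by lia, f, y, rfl⟩
      · exact ⟨n, by lia, stdSimplex.objEquiv β, y, rfl⟩
    · rintro ⟨p, hp, f, y, rfl⟩
      obtain hp | rfl := (Nat.lt_succ_iff.1 hp).lt_or_eq
      · exact Or.inl ⟨p, hp, f, y, rfl⟩
      · exact Or.inr ⟨⟨y, stdSimplex.objEquiv.symm f⟩, rfl⟩

/-- Identifies the attaching locus of `Y n ⊗ Δ[n]`. A section of a surjective `f` recovers `y` from
its image, so `y` is in `A` or horizontally degenerate; a non-surjective `f` factors through a face.
-/
lemma Sub.preimage_filtration (n : ℕ) :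
    (A.filtration n).preimage (toDiag Y n) = (A.latching n).unionProd ∂Δ[n] := by
  ext ⟨d⟩ ⟨y, β⟩
  induction d using SimplexCategory.rec with | _ d
  obtain ⟨f, rfl⟩ := stdSimplex.objEquiv.symm.surjective β
  refine Iff.trans ?_ (Subcomplex.mem_unionProd_iff _ _ _).symm
  change (Y.flip.obj _).map f.op y ∈ (A.filtration n).obj _ ↔ _
  rw [mem_filtration_iff]
  constructor
  · intro h
    by_cases hf : Epi f
    · obtain ⟨⟨hf⟩⟩ := isSplitEpi_of_epi f
      have hy : (Y.flip.obj (op ⦋d⦌)).map hf.section_.op ((Y.flip.obj _).map f.op y) = y := by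
        rw [← Functor.map_comp_apply, ← op_comp, hf.id]
        simp
      right
      obtain h | ⟨p, hp, g, z, h⟩ := h
      · left
        rw [← hy]
        exact A.map_mem _ h
      · right
        rw [← h] at hy
        refine ⟨p, hp, hf.section_ ≫ g, z, ?_⟩
        rw [← hy]
        simp
    · left
      rwa [SimplexCategory.epi_iff_surjective] at hf
  · rintro (h | h | ⟨m, hm, g, z, rfl⟩)
    · obtain _ | n := n
      · exact (h fun i ↦ ⟨0, Subsingleton.elim (α := Fin 1) _ _⟩).elim
      · obtain ⟨i, g, rfl⟩ := SimplexCategory.eq_comp_δ_of_not_surjective f h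
        exact Or.inr ⟨n, by lia, g, (Y.flip.obj _).map (SimplexCategory.δ i).op y, by simp⟩
    · exact Or.inl (A.map_mem _ h)
    · exact Or.inr ⟨m, hm, f ≫ g, z, by simp⟩

/-- Outside the attaching locus, `x.1` is horizontally nondegenerate and `x.2` is surjective;
Eilenberg–Zilber uniqueness determines both. -/
lemma Sub.toDiag_injOn (n : ℕ) (k : SimplexCategoryᵒᵖ) (x y : (Y.obj (op ⦋n⦌) ⊗ Δ[n]).obj k)
    (hx : (toDiag Y n).app k x ∉ (A.filtration n).obj k)
    (hy : (toDiag Y n).app k y ∉ (A.filtration n).obj k)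
    (h : (toDiag Y n).app k x = (toDiag Y n).app k y) : x = y := by
  have (z : (Y.obj (op ⦋n⦌) ⊗ Δ[n]).obj k)
    (hz : (toDiag Y n).app k z ∉ (A.filtration n).obj k) :
      z.1 ∉ SSet.degenerate (Y.flip.obj k) n ∧ Epi (stdSimplex.objEquiv z.2) := by
    change z ∉ ((A.filtration n).preimage (toDiag Y n)).obj k at hz
    rw [preimage_filtration] at hz
    replace hz := mt (Subcomplex.mem_unionProd_iff (A.latching n) ∂Δ[n] z).2 hz
    refine ⟨fun h ↦ hz (Or.inr (Or.inr h)), ?_⟩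
    rw [SimplexCategory.epi_iff_surjective]
    by_contra h
    exact hz (Or.inl h)
  obtain ⟨hx₁, hx₂⟩ := this x hx
  obtain ⟨hy₁, hy₂⟩ := this y hy
  obtain ⟨d⟩ := k
  induction d using SimplexCategory.rec with | _ d
  have h₁ := SSet.unique_nonDegenerate_simplex (Y.flip.obj (op ⦋d⦌)) _
    (stdSimplex.objEquiv x.2) ⟨x.1, hx₁⟩ rfl
    (stdSimplex.objEquiv y.2) ⟨y.1, hy₁⟩ h
  have h₂ := SSet.unique_nonDegenerate_map (Y.flip.obj (op ⦋d⦌)) _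
    (stdSimplex.objEquiv x.2) ⟨x.1, hx₁⟩ rfl
    (stdSimplex.objEquiv y.2) ⟨y.1, hy₁⟩ h
  exact Prod.ext (congrArg Subtype.val h₁) (stdSimplex.objEquiv.injective h₂)

/-- A levelwise weakly invertible inclusion of bisimplicial sets induces a weak homotopy
equivalence on diagonals. -/
lemma Sub.isWeakHomotopyEquiv_diag (hA : ∀ n, IsWeakHomotopyEquiv (A.obj n).ι) :
    IsWeakHomotopyEquiv A.diag.ι := by
  refine IsWeakHomotopyEquiv.of_filtration A.filtration A.filtration_le ?_ ?_
  · rintro ⟨d⟩ x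
    induction d using SimplexCategory.rec with | _ d
    refine ⟨d + 1, ?_⟩
    -- A simplex of dimension `d` comes from column `d` with the identity of `⦋d⦌`, hence appears at
    -- stage `d + 1`.
    exact (A.mem_filtration_iff _ _).2 (Or.inr ⟨d, by lia, 𝟙 _, x, by simp; rfl⟩)
  · intro n
    refine IsWeakHomotopyEquiv.sup_range (toDiag Y n) (A.filtration n) (A.toDiag_injOn n) ?_
    rw [preimage_filtration]
    exact (A.isWeakHomotopyEquiv_latching hA n).unionProd _ _

end Bisimplicial
end SSet

/-! ### Functorial embedding into a contractible simplicial set. -/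

namespace SSet

/-- The cofree simplicial set on the pointed sets obtained by adding a point to each of the
sets of simplices of a simplicial set `S`. It contains `S` and is contractible. -/
def cofreeCone : SSet.{u} ⥤ SSet.{u} where
  obj S :=
    { obj m := ∀ k : SimplexCategory, (k ⟶ m.unop) → Option (S.obj (op k))
      map ψ := ↾fun x k φ ↦ x k (φ ≫ ψ.unop) }
  map f := { app m := ↾fun x k φ ↦ (x k φ).map (f.app (op k)) }

/-- The inclusion of a simplicial set in its cofree cone. -/
def toCofreeCone : 𝟭 SSet.{u} ⟶ cofreeCone where
  app S :=
    { app m := ↾fun x k φ ↦ some (S.map φ.op x)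
      naturality m m' ψ := by
        ext x
        funext k φ
        exact congrArg some (ConcreteCategory.congr_hom (S.map_comp ψ φ.op) x).symm }
  naturality S T f := by
    ext m x
    funext k φ
    exact congrArg some (NatTrans.naturality_apply f φ.op x).symm

lemma toCofreeCone_app_injective (S : SSet.{u}) (m : SimplexCategoryᵒᵖ) :
    Function.Injective ((toCofreeCone.app S).app m) := by
  intro x y h
  replace h : some (S.map (𝟙 m.unop).op x) = some (S.map (𝟙 m.unop).op y) :=
    congrFun (congrFun h m.unop) (𝟙 _)
  simpa using h

open Classical in
/-- The contraction of the cofree cone. -/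
noncomputable def cofreeConeContraction : cofreeCone ⋙ tensorRight Δ[1] ⟶ cofreeCone.{u} where
  app S :=
    { app m := ↾fun x k φ ↦
        -- Coordinates landing over the vertex `0` of `Δ[1]` are kept and the others become the base
        -- point. At the end `1` none survive, because `k` has a vertex.
        if ∀ i, (φ ≫ stdSimplex.objEquiv x.2).toOrderHom i = 0 then x.1 k φ else none }
  naturality S T f := by
    ext m ⟨x, β⟩
    funext k φ
    by_cases h : ∀ i, (φ ≫ stdSimplex.objEquiv β).toOrderHom i = 0
    · exact (if_pos h).trans
        (congrArg (Option.map (f.app (op k))) (if_pos (t := x k φ) (e := none) h)).symm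
    · exact (if_neg h).trans
        (congrArg (Option.map (f.app (op k))) (if_neg (t := x k φ) (e := none) h)).symm

/-- The base point of the cofree cone. -/
def cofreeConePoint (S T : SSet.{u}) : T ⟶ cofreeCone.obj S where
  app m := ↾fun _ _ _ ↦ none

lemma ι₀_cofreeConeContraction (S : SSet.{u}) :
    ι₀ ≫ cofreeConeContraction.app S = 𝟙 (cofreeCone.obj S) := by
  ext m x
  funext k φ
  exact if_pos fun i ↦ rfl

lemma ι₁_cofreeConeContraction (S : SSet.{u}) :
    ι₁ ≫ cofreeConeContraction.app S = cofreeConePoint S _ := by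
  ext m x
  funext k φ
  exact if_neg fun h ↦ one_ne_zero (α := Fin 2) (h 0)

/-- The homotopy that contracts the fibres of a projection to the first factor. -/
lemma isWeakHomotopyEquiv_fst_cofreeCone (T S : SSet.{u}) :
    IsWeakHomotopyEquiv (fst T (cofreeCone.obj S)) := by
  refine .of_homotopic_id (s := lift (𝟙 T) (cofreeConePoint S T)) (by simp)
    ⟨(α_ _ _ _).hom ≫ T ◁ cofreeConeContraction.app S, ?_, ?_⟩
  · change T ◁ (ι₀ ≫ cofreeConeContraction.app S) = _
    rw [ι₀_cofreeConeContraction, whiskerLeft_id]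
  · change T ◁ (ι₁ ≫ cofreeConeContraction.app S) = _
    rw [ι₁_cofreeConeContraction]
    rfl

namespace Bisimplicial

variable (X : Bisimplicial.{u}) (L : SSet.{u})

/-- The bisimplicial set `n ↦ L_n ⊗ cofreeCone X_n`. -/
def coneOver : Bisimplicial.{u} where
  obj n := (Functor.const _).obj (L.obj n) ⊗ cofreeCone.obj (X.obj n)
  map φ := (Functor.const _).map (L.map φ) ⊗ₘ cofreeCone.map (X.map φ)

/-- The projection of the diagonal of `coneOver X L` to `L`. -/
def diagConeOverFst : diag (coneOver X L) ⟶ L where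
  app n := ↾fun x ↦ x.1

/-- The contraction is natural in `S`, so it acts on the diagonal itself; no comparison of columns
is needed. -/
lemma isWeakHomotopyEquiv_diagConeOverFst : IsWeakHomotopyEquiv (diagConeOverFst X L) := by
  let s : L ⟶ diag (coneOver X L) := { app n := ↾fun l ↦ ⟨l, fun _ _ ↦ none⟩ }
  refine .of_homotopic_id (s := s) rfl ⟨{
    app n := ↾fun x ↦ ⟨x.1.1, (cofreeConeContraction.app (X.obj n)).app n ⟨x.1.2, x.2⟩⟩
    naturality n m φ := ?_ }, ?_, ?_⟩
  · refine ConcreteCategory.hom_ext _ _ fun ⟨⟨l, x⟩, β⟩ ↦ ?_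
    have h₁ := NatTrans.naturality_apply (cofreeConeContraction.app (X.obj n)) φ ⟨x, β⟩
    have h₂ := ConcreteCategory.congr_hom (congr_app (cofreeConeContraction.naturality (X.map φ)) m)
      ⟨(cofreeCone.obj (X.obj n)).map φ x, Δ[1].map φ β⟩
    exact Prod.ext rfl (h₂.trans (congrArg ((cofreeCone.map (X.map φ)).app m) h₁))
  · refine NatTrans.ext (funext fun n ↦ ConcreteCategory.hom_ext _ _ fun ⟨l, x⟩ ↦ ?_)
    have h := ConcreteCategory.congr_hom
      (congr_app (ι₀_cofreeConeContraction (X.obj n)) n) x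
    exact Prod.ext rfl h
  · refine NatTrans.ext (funext fun n ↦ ConcreteCategory.hom_ext _ _ fun ⟨l, x⟩ ↦ ?_)
    have h := ConcreteCategory.congr_hom
      (congr_app (ι₁_cofreeConeContraction (X.obj n)) n) x
    exact Prod.ext rfl h

end Bisimplicial

end SSet

/-! ### Disjoint unions and maps of diagonals. -/

namespace SSet

section Sigma

variable {I : Type u} (S : I → SSet.{u})

/-- The disjoint union of a family of simplicial sets. -/
def sigmaObj : SSet.{u} where
  obj m := Σ i, (S i).obj m
  map φ := ↾fun x ↦ ⟨x.1, (S x.1).map φ x.2⟩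

/-- The inclusion of a summand of a disjoint union. -/
def sigmaι (i : I) : S i ⟶ sigmaObj S where
  app m := ↾fun x ↦ ⟨i, x⟩

variable {S}

/-- The map from a disjoint union given by a family of maps. -/
def sigmaDesc {Z : SSet.{u}} (g : ∀ i, S i ⟶ Z) : sigmaObj S ⟶ Z where
  app m := ↾fun x ↦ (g x.1).app m x.2
  naturality _ _ φ := by
    ext x
    exact NatTrans.naturality_apply (g x.1) φ x.2

lemma sigmaObj_hom_ext {Z : SSet.{u}} {f g : sigmaObj S ⟶ Z}
    (h : ∀ i, sigmaι S i ≫ f = sigmaι S i ≫ g) : f = g := by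
  ext m x
  exact ConcreteCategory.congr_hom (congr_app (h x.1) m) x.2

lemma Homotopic.of_sigmaι {Z : SSet.{u}} {f g : sigmaObj S ⟶ Z}
    (h : ∀ i, Homotopic (sigmaι S i ≫ f) (sigmaι S i ≫ g)) : Homotopic f g := by
  choose H hH₀ hH₁ using h
  refine ⟨{
    app m := ↾fun x ↦ (H x.1.1).app m ⟨x.1.2, x.2⟩
    naturality _ _ φ := ?_ }, sigmaObj_hom_ext hH₀, sigmaObj_hom_ext hH₁⟩
  ext x
  exact NatTrans.naturality_apply (H x.1.1) φ ⟨x.1.2, x.2⟩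

lemma isWeakHomotopyEquiv_sigmaDesc {T : I → SSet.{u}} (f : ∀ i, S i ⟶ T i)
    (hf : ∀ i, IsWeakHomotopyEquiv (f i)) :
    IsWeakHomotopyEquiv (sigmaDesc fun i ↦ f i ≫ sigmaι T i) := by
  simp only [isWeakHomotopyEquiv_iff] at hf ⊢
  refine fun Z _ ↦ ⟨fun g ↦ ?_, fun h h' H ↦ .of_sigmaι fun i ↦ (hf i Z).2 _ _ ?_⟩
  · choose h hh using fun i ↦ (hf i Z).1 (sigmaι S i ≫ g)
    exact ⟨sigmaDesc h, .of_sigmaι hh⟩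
  · exact H.precomp (sigmaι S i)

end Sigma

lemma isIso_of_bijective {A B : SSet.{u}} (f : A ⟶ B)
    (hf : ∀ m, Function.Bijective (f.app m)) : IsIso f := by
  have (m : SimplexCategoryᵒᵖ) : IsIso (f.app m) := (isIso_iff_bijective _).2 (hf m)
  exact NatIso.isIso_of_isIso_app f

lemma isIso_toRange {A B : SSet.{u}} (f : A ⟶ B) (hf : ∀ m, Function.Injective (f.app m)) :
    IsIso (Subcomplex.toRange f) := by
  refine isIso_of_bijective _ fun m ↦ ⟨fun x y h ↦ hf m (congrArg Subtype.val h), ?_⟩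
  rintro ⟨_, x, rfl⟩
  exact ⟨x, rfl⟩

/-- The projection from a disjoint union to the set of summands. -/
def sigmaFst {I : Type u} (S : I → SSet.{u}) : sigmaObj S ⟶ (Functor.const _).obj I where
  app _ := ↾fun x ↦ x.1

lemma isIso_sigmaFst (I : Type u) : IsIso (sigmaFst (fun _ : I ↦ (Δ[0] : SSet.{u}))) := by
  refine isIso_of_bijective _ fun m ↦ ⟨?_, fun i ↦ ?_⟩
  · rintro ⟨i, x⟩ ⟨j, y⟩ h
    obtain rfl : i = j := h
    refine congrArg (Sigma.mk i) (stdSimplex.objEquiv.injective ?_)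
    exact Subsingleton.elim (α := (m.unop ⟶ ⦋0⦌)) _ _
  · exact ⟨⟨i, stdSimplex.objEquiv.symm (SimplexCategory.const _ _ 0)⟩, rfl⟩

lemma isWeakHomotopyEquiv_sigmaFst {I : Type u} (S : I → SSet.{u})
    (hS : ∀ i, (S i).IsContractible) : IsWeakHomotopyEquiv (sigmaFst S) := by
  have h := isWeakHomotopyEquiv_sigmaDesc _ hS
  have := isIso_sigmaFst I
  have h' := h.comp (.of_isIso (sigmaFst _))
  have h'' : (sigmaDesc fun i ↦ stdSimplex.isTerminalObj₀.from (S i) ≫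
      sigmaι (fun _ ↦ (Δ[0] : SSet.{u})) i) ≫ sigmaFst _ = sigmaFst S :=
    sigmaObj_hom_ext fun _ ↦ rfl
  rwa [h''] at h'

namespace Bisimplicial

/-- The map induced on diagonals by a map of bisimplicial sets. -/
def diagMap {X Y : Bisimplicial.{u}} (η : X ⟶ Y) : diag X ⟶ diag Y where
  app n := (η.app n).app n
  naturality n m φ := by
    ext x
    exact (ConcreteCategory.congr_hom (congr_app (η.naturality φ) m) _).trans
      (congrArg ((Y.map φ).app m) (NatTrans.naturality_apply (η.app n) φ x))

/-- The range of a map of bisimplicial sets. -/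
def range {X Y : Bisimplicial.{u}} (η : X ⟶ Y) : Sub Y where
  obj n := Subcomplex.range (η.app n)
  map φ := by
    rintro k _ ⟨x, rfl⟩
    exact ⟨(X.map φ).app k x, ConcreteCategory.congr_hom (congr_app (η.naturality φ) k) x⟩

lemma range_diagMap {X Y : Bisimplicial.{u}} (η : X ⟶ Y) :
    Subcomplex.range (diagMap η) = (range η).diag := rfl

lemma isWeakHomotopyEquiv_diagMap {X Y : Bisimplicial.{u}} (η : X ⟶ Y)
    (hη : ∀ n m, Function.Injective ((η.app n).app m))
    (h : ∀ n, IsWeakHomotopyEquiv (η.app n)) : IsWeakHomotopyEquiv (diagMap η) := by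
  have hA : IsWeakHomotopyEquiv (Subcomplex.range (diagMap η)).ι := by
    rw [range_diagMap]
    refine (range η).isWeakHomotopyEquiv_diag fun n ↦ ?_
    have := isIso_toRange (η.app n) (hη n)
    have h' := h n
    rw [← Subcomplex.toRange_ι (η.app n)] at h'
    exact .of_comp_left (.of_isIso (Subcomplex.toRange (η.app n))) h'
  have := isIso_toRange (diagMap η) fun m ↦ hη m m
  rw [← Subcomplex.toRange_ι (diagMap η)]
  exact .comp (.of_isIso _) hA

end Bisimplicial

lemma yonedaEquiv_symm_map (L : SSet.{u}) {n m : SimplexCategoryᵒᵖ} (φ : n ⟶ m) (x : L.obj n) :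
    yonedaEquiv.symm (L.map φ x) = stdSimplex.{u}.map φ.unop ≫ yonedaEquiv.symm x := by
  apply yonedaEquiv.injective
  rw [Equiv.apply_symm_apply, ← yonedaEquiv_naturality, Equiv.apply_symm_apply]
  rfl

/-! ### The bisimplicial set of partial sections. -/

section

variable {K L : SSet.{u}} (f : K ⟶ L)

/-- The disjoint union over the `n`-simplices of `L` of the simplicial sets
of partial sections of `f`. -/
def partialSectionsColumn (n : SimplexCategoryᵒᵖ) : SSet.{u} where
  obj m := { p : L.obj n × (stdSimplex.{u}.obj m.unop ⊗ stdSimplex.{u}.obj n.unop ⟶ K) //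
    p.2 ≫ f = snd _ _ ≫ yonedaEquiv.symm p.1 }
  map φ := ↾fun p ↦ ⟨(p.1.1, stdSimplex.{u}.map φ.unop ▷ _ ≫ p.1.2), by
    rw [Category.assoc, p.2, whiskerRight_snd_assoc]⟩
  map_id m := by
    ext p : 3
    refine Subtype.ext (Prod.ext rfl ?_)
    have h : stdSimplex.{u}.map (𝟙 m.unop) = 𝟙 _ := CategoryTheory.Functor.map_id _ _
    change stdSimplex.{u}.map (𝟙 m.unop) ▷ _ ≫ p.1.2 = p.1.2
    rw [h, id_whiskerRight, Category.id_comp]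
  map_comp φ ψ := by
    ext p : 3
    refine Subtype.ext (Prod.ext rfl ?_)
    have h : stdSimplex.{u}.map (ψ.unop ≫ φ.unop) =
        stdSimplex.{u}.map ψ.unop ≫ stdSimplex.{u}.map φ.unop :=
      CategoryTheory.Functor.map_comp _ _ _
    change stdSimplex.{u}.map (ψ.unop ≫ φ.unop) ▷ _ ≫ p.1.2 = _
    rw [h, comp_whiskerRight, Category.assoc]
    rfl

/-- The restriction of partial sections along a map between standard simplices. -/
def partialSectionsColumnMap {n n' : SimplexCategoryᵒᵖ} (φ : n ⟶ n') :
    partialSectionsColumn f n ⟶ partialSectionsColumn f n' where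
  app m := ↾fun p ↦ ⟨(L.map φ p.1.1, _ ◁ stdSimplex.{u}.map φ.unop ≫ p.1.2), by
    rw [Category.assoc, p.2, whiskerLeft_snd_assoc, yonedaEquiv_symm_map]⟩
  naturality m m' ψ := by
    ext p : 3
    refine Subtype.ext (Prod.ext rfl ?_)
    exact (whisker_exchange_assoc _ _ p.1.2)

/-- The bisimplicial set whose `n`-th column is the disjoint union over the `n`-simplices of `L`
of the simplicial sets of partial sections of `f`. -/
def partialSections : Bisimplicial.{u} where
  obj n := partialSectionsColumn f n
  map φ := partialSectionsColumnMap f φ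
  map_id n := by
    refine NatTrans.ext (funext fun m ↦ ?_)
    ext p : 3
    have h₀ := ConcreteCategory.congr_hom (L.map_id n) p.1.1
    refine Subtype.ext (Prod.ext h₀ ?_)
    have h : stdSimplex.{u}.map (𝟙 n.unop) = 𝟙 _ := CategoryTheory.Functor.map_id _ _
    change _ ◁ stdSimplex.{u}.map (𝟙 n.unop) ≫ p.1.2 = p.1.2
    rw [h, whiskerLeft_id, Category.id_comp]
  map_comp φ ψ := by
    refine NatTrans.ext (funext fun m ↦ ?_)
    ext p : 3
    have h₀ := ConcreteCategory.congr_hom (L.map_comp φ ψ) p.1.1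
    refine Subtype.ext (Prod.ext h₀ ?_)
    have h : stdSimplex.{u}.map (ψ.unop ≫ φ.unop) =
        stdSimplex.{u}.map ψ.unop ≫ stdSimplex.{u}.map φ.unop :=
      CategoryTheory.Functor.map_comp _ _ _
    change _ ◁ stdSimplex.{u}.map (ψ.unop ≫ φ.unop) ≫ p.1.2 = _
    rw [h, whiskerLeft_comp, Category.assoc]
    rfl

/-- The projection of a column of `partialSections f` to the set of simplices of `L`. -/
def partialSectionsFst (n : SimplexCategoryᵒᵖ) :
    (partialSections f).obj n ⟶ (Functor.const _).obj (L.obj n) where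
  app m := ↾fun p ↦ p.1.1

lemma isWeakHomotopyEquiv_partialSectionsFst
    (hf : ∀ (n : ℕ) (σ : Δ[n] ⟶ L), (relHom (𝟙 Δ[n]) (Limits.pullback.fst σ f)).IsContractible)
    (n : SimplexCategoryᵒᵖ) : IsWeakHomotopyEquiv (partialSectionsFst f n) := by
  obtain ⟨n⟩ := n
  induction n using SimplexCategory.rec with | _ n
  let S (σ : L _⦋n⦌) : SSet.{u} :=
    relHom (𝟙 Δ[n]) (Limits.pullback.fst (yonedaEquiv.symm σ) f)
  let e : sigmaObj S ⟶ (partialSections f).obj (op ⦋n⦌) := sigmaDesc fun σ ↦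
    { app m := ↾fun g ↦ ⟨(σ, g.1 ≫ Limits.pullback.snd _ f), by
        rw [Category.assoc, ← Limits.pullback.condition, ← Category.assoc]
        exact congrArg (· ≫ yonedaEquiv.symm σ) (g.2.trans (Category.comp_id _))⟩
      naturality m m' φ := by
        ext g
        exact Subtype.ext (Prod.ext rfl (Category.assoc _ _ _)) }
  -- By the universal property of the pullback, sections over `σ` are maps to `K` lying over `σ`, so
  -- the column splits into the simplicial sets of the hypothesis.
  have : IsIso e := by
    refine isIso_of_bijective e fun m ↦ ⟨?_, ?_⟩
    · rintro ⟨σ, g⟩ ⟨τ, h⟩ H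
      obtain rfl : σ = τ := congrArg (fun p ↦ p.1.1) H
      refine congrArg (Sigma.mk σ) (Subtype.ext (Limits.pullback.hom_ext ?_ ?_))
      · exact g.2.trans h.2.symm
      · exact congrArg (fun p ↦ p.1.2) H
    · rintro ⟨⟨σ, g⟩, hg⟩
      refine ⟨⟨σ, Limits.pullback.lift (snd _ _) g hg.symm, ?_⟩, ?_⟩
      · exact (Limits.pullback.lift_fst _ _ _).trans (Category.comp_id _).symm
      · exact Subtype.ext (Prod.ext rfl (Limits.pullback.lift_snd _ _ _))
  exact .of_comp_left (.of_isIso e) (isWeakHomotopyEquiv_sigmaFst S fun σ ↦ hf n _)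

/-- The inclusion of `partialSections f` in its levelwise cone. -/
def partialSectionsToCone :
    partialSections f ⟶ Bisimplicial.coneOver (partialSections f) L where
  app n := lift (partialSectionsFst f n) (toCofreeCone.app _)
  naturality n m φ := by
    ext k p
    have h := ConcreteCategory.congr_hom
      (congr_app (toCofreeCone.naturality ((partialSections f).map φ)) k) p
    exact Prod.ext rfl h

/-- The map `diag (partialSections f) ⟶ K` which evaluates partial sections. -/
def partialSectionsEval : Bisimplicial.diag (partialSections f) ⟶ K where
  app n := ↾fun p ↦ p.1.2.app n
    ⟨stdSimplex.objEquiv.symm (𝟙 _), stdSimplex.objEquiv.symm (𝟙 _)⟩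
  naturality n m φ := by
    ext p
    refine Eq.trans ?_ (NatTrans.naturality_apply p.1.2 φ _)
    change p.1.2.app m ⟨stdSimplex.objEquiv.symm _, stdSimplex.objEquiv.symm _⟩ =
      p.1.2.app m ⟨stdSimplex.objEquiv.symm _, stdSimplex.objEquiv.symm _⟩
    congr 1

/-- The map `K ⟶ diag (partialSections f)` which sends a simplex to the constant family of
partial sections. -/
def toPartialSections : K ⟶ Bisimplicial.diag (partialSections f) where
  app n := ↾fun x ↦ ⟨(f.app n x, snd _ _ ≫ yonedaEquiv.symm x), by
    rw [Category.assoc, yonedaEquiv_symm_comp]⟩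
  naturality n m φ := by
    ext x
    have h := NatTrans.naturality_apply f φ x
    refine Subtype.ext (Prod.ext h ?_)
    change snd _ _ ≫ yonedaEquiv.symm (K.map φ x) =
      _ ◁ stdSimplex.{u}.map φ.unop ≫ stdSimplex.{u}.map φ.unop ▷ _ ≫ snd _ _ ≫ yonedaEquiv.symm x
    rw [yonedaEquiv_symm_map]
    rfl

lemma toPartialSections_eval : toPartialSections f ≫ partialSectionsEval f = 𝟙 K := by
  ext n x
  exact ConcreteCategory.congr_hom (K.map_id n) x

/-- A partial section over `σ` composes with `f` to `snd ≫ σ`, whose value at the pair of identities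
is `σ`. -/
lemma partialSectionsEval_comp : partialSectionsEval f ≫ f =
    Bisimplicial.diagMap (partialSectionsToCone f) ≫ Bisimplicial.diagConeOverFst _ L := by
  ext n p
  have h := ConcreteCategory.congr_hom (congr_app p.2 n)
    ⟨stdSimplex.objEquiv.symm (𝟙 _), stdSimplex.objEquiv.symm (𝟙 _)⟩
  exact h.trans (ConcreteCategory.congr_hom (L.map_id n) p.1.1)

end

end SSet

theorem mainTheorem5 {K L : SSet.{u}} (f : K ⟶ L)
    (hf : ∀ (n : ℕ) (σ : Δ[n] ⟶ L),
      (SSet.relHom (𝟙 Δ[n]) (Limits.pullback.fst σ f)).IsContractible) :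
    SSet.IsWeakHomotopyEquiv f := by
  refine .of_retraction (SSet.toPartialSections_eval f) ?_
  rw [SSet.partialSectionsEval_comp]
  refine .comp (SSet.Bisimplicial.isWeakHomotopyEquiv_diagMap _ (fun n m x y h ↦ ?_) fun n ↦ ?_)
    (SSet.Bisimplicial.isWeakHomotopyEquiv_diagConeOverFst _ L)
  · exact SSet.toCofreeCone_app_injective _ _ (congrArg Prod.snd h)
  -- Two-out-of-three: followed by the projection from the cone, the embedding of a column is
  -- `partialSectionsFst f n`.
  · exact .of_comp_right (SSet.isWeakHomotopyEquiv_fst_cofreeCone _ _)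
      (SSet.isWeakHomotopyEquiv_partialSectionsFst f hf n)
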